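/- Let $\mathbb{K}$ be a field and let $\mathbb{K}((t^{-1}))$ be the field of Laurent series $\alpha=\sum_{n\in\mathbb{Z}}\alpha_n t^{-n}$ with coefficients $\alpha_n\in\mathbb{K}$, only finitely many of the coefficients of positive powers of $t$ being nonzero. Every $\alpha\in\mathbb{K}((t^{-1}))$ has a unique continued fraction expansion $\alpha=[a_0(\alpha);a_1(\alpha),a_2(\alpha),\dots]$, finite or infinite, with partial quotients $a_n(\alpha)\in\mathbb{K}[t]$ such that $\deg a_n(\alpha)\ge 1$ for $n\ge 1$. For $k\ge 1$ let $\mathcal{F}(k)$ be the set of all $\alpha\in\mathbb{K}((t^{-1}))$ such that, for every $n\ge 1$, $a_n(\alpha)$ is defined and $\deg a_n(\alpha)\le k$ (in particular, the expansion of $\alpha$ is infinite). If $\mathbb{K}\neq\mathbb{F}_2$, then $$\mathcal{F}(1)+\mathcal{F}(1)=\mathbb{K}((t^{-1})).$$ If $\mathbb{K}=\mathbb{F}_2$, then this equality does not hold, and indeed $t^{-1}\notin\mathcal{F}(1)+\mathcal{F}(1)$, but $$\mathcal{F}(2)+\mathcal{F}(1)=\mathbb{F}_2((t^{-1})).$$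 -/

import Mathlib

open scoped Pointwise LaurentSeries Polynomial

namespace LaurentCF

noncomputable section

variable {K : Type*} [Field K]

/-! The field `K((t⁻¹))` is `K⸨X⸩`, Laurent series with finitely many negative powers of the
variable `X = t⁻¹`.  So `α.coeff n` is the coefficient of `t ^ (-n)` in `α`, and `t` itself is
`X⁻¹`, the series `HahnSeries.single (-1) 1`. -/

/-- The element `t⁻¹` of `K((t⁻¹))`. -/
def tInv (K : Type*) [Field K] : K⸨X⸩ := HahnSeries.single (1 : ℤ) (1 : K)

/-- The embedding of the polynomial ring `K[t]` in `K((t⁻¹))`, sending the variable to `t`. -/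
def ofPoly (K : Type*) [Field K] : K[X] →+* K⸨X⸩ :=
  Polynomial.eval₂RingHom (HahnSeries.C : K →+* K⸨X⸩) (HahnSeries.single (-1 : ℤ) (1 : K))

/-- The polynomial part of a Laurent series: the terms with nonnegative powers of `t`. -/
def polyPart (α : K⸨X⸩) : K[X] :=
  ∑ n ∈ Finset.range ((-α.order).toNat + 1), Polynomial.monomial n (α.coeff (-(n : ℤ)))

/-- All nonnegative powers of `t` are taken into account by `polyPart`. -/
theorem coeff_polyPart (α : K⸨X⸩) (n : ℕ) : (polyPart α).coeff n = α.coeff (-(n : ℤ)) := by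
  simp only [polyPart, Polynomial.finsetSum_coeff, Polynomial.coeff_monomial,
    Finset.sum_ite_eq', Finset.mem_range]
  split_ifs with h
  · rfl
  · exact (HahnSeries.coeff_eq_zero_of_lt_order (by omega)).symm

open Classical in
/-- The complete quotients of the continued fraction algorithm: the `0`th one is `α`, and the one
following `β` is `1 / (β - polyPart β)`.  The expansion ends (value `none`) after a complete
quotient that is a polynomial. -/
def completeQuotient (α : K⸨X⸩) : ℕ → Option K⸨X⸩
  | 0 => some α
  | n + 1 => (completeQuotient α n).bind fun β =>
      if β - ofPoly K (polyPart β) = 0 then none else some (β - ofPoly K (polyPart β))⁻¹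

/-- The `n`th partial quotient `aₙ(α)` of `α = [a₀; a₁, a₂, …]`; it is `none` if the expansion
of `α` ends before the index `n`. -/
def partialQuotient (α : K⸨X⸩) (n : ℕ) : Option K[X] :=
  (completeQuotient α n).map polyPart

/-- The set `F(k)` of the Laurent series for which `aₙ(α)` is defined and of degree at most `k`
for every `n ≥ 1`.  In particular the continued fraction expansion of `α` is infinite. -/
def F (K : Type*) [Field K] (k : ℕ) : Set K⸨X⸩ :=
  {α | ∀ n : ℕ, 1 ≤ n → ∃ a : K[X], partialQuotient α n = some a ∧ a.degree ≤ (k : WithBot ℕ)}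

end

end LaurentCF

namespace LaurentCF

open Polynomial

/-! The sizes of the nonsingular Hankel matrices `(a (i + j))` of a series are the degrees of its
convergent denominators, so gaps of at most `m` between them bound the degrees of the partial
quotients by `m` (`mem_F_of_hankelNonsingular`). Given `γ`, the coefficients of a summand `α` are
chosen one by one. If size `k` is nonsingular, the determinant of size `k + 1` is affine in the term
`2 * k` with nonzero slope, so one value is forbidden. Both `α` and `γ - α` forbid one value, and a
third element of `K` serves both. Over `F₂` only `α` is kept nonsingular at every size; `γ - α` may
miss one size and recovers at the next (`exists_sequence_two`). Series in `F(1)` have a nonzero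
coefficient at `t⁻¹`; over `F₂` two such coefficients add up to `0`, which excludes `t⁻¹`. -/

variable {K : Type*} [Field K]

/-! ### Hankel matrices and orthogonal polynomials -/

/-- The linear functional on polynomials sending `X ^ n` to `a n`. -/
noncomputable def moment (a : ℕ → K) : K[X] →ₗ[K] K :=
  Polynomial.lsum fun n => a n • LinearMap.id

theorem moment_monomial (a : ℕ → K) (n : ℕ) (c : K) : moment a (monomial n c) = a n * c := by
  simp [moment, Polynomial.sum_monomial_index]

theorem moment_eq_sum (a : ℕ → K) (q : K[X]) (n : ℕ) (h : q.degree < n) :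
    moment a q = ∑ j ∈ Finset.range n, a j * q.coeff j := by
  by_cases hq : q = 0
  · simp [hq]
  conv_lhs => rw [q.as_sum_range' n ((natDegree_lt_iff_degree_lt hq).2 h)]
  simp [moment_monomial]

theorem moment_congr {a b : ℕ → K} {n : ℕ} (hab : ∀ i < n, a i = b i) {q : K[X]}
    (h : q.degree < n) : moment a q = moment b q := by
  rw [moment_eq_sum a q n h, moment_eq_sum b q n h]
  exact Finset.sum_congr rfl fun i hi => by rw [hab i (Finset.mem_range.1 hi)]

/-- The Hankel matrix `(a (i + j))` of size `k` is nonsingular, expressed by its kernel, whose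
vectors are regarded as polynomials of degree less than `k`. -/
def HankelNonsingular (a : ℕ → K) (k : ℕ) : Prop :=
  ∀ q : K[X], q.degree < k → (∀ i < k, moment a (X ^ i * q) = 0) → q = 0

theorem hankelNonsingular_zero (a : ℕ → K) : HankelNonsingular a 0 := by
  intro q hq _
  simpa using hq

theorem degree_X_pow_mul_lt {q : K[X]} {k : ℕ} (hq : q.degree < k) (i : ℕ) :
    (X ^ i * q).degree < ((i + k : ℕ) : WithBot ℕ) := by
  by_cases h0 : q = 0
  · simp [h0]
  · rw [degree_mul, degree_X_pow, degree_eq_natDegree h0] at *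
    norm_cast at *
    omega

/-- The entries of the matrix of size `k` have indices at most `2 * k - 2`. -/
theorem HankelNonsingular.congr {a b : ℕ → K} {k : ℕ} (h : HankelNonsingular a k)
    (hab : ∀ i < 2 * k - 1, a i = b i) : HankelNonsingular b k := by
  intro q hq hb
  refine h q hq fun i hi => ?_
  rw [← hb i hi]
  refine moment_congr (n := i + k) (fun j hj => hab j (by omega)) (degree_X_pow_mul_lt hq i)

/-- A nonsingular Hankel matrix yields an orthogonal polynomial of the corresponding degree. -/
theorem HankelNonsingular.exists_monic {a : ℕ → K} {k : ℕ} (h : HankelNonsingular a k) :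
    ∃ q : K[X], q.Monic ∧ q.natDegree = k ∧ ∀ i < k, moment a (X ^ i * q) = 0 := by
  let T : degreeLT K k →ₗ[K] (Fin k → K) :=
    LinearMap.pi fun i => (moment a ∘ₗ LinearMap.mulLeft K (X ^ (i : ℕ))) ∘ₗ (degreeLT K k).subtype
  have hT : Function.Injective T := by
    rw [injective_iff_map_eq_zero]
    rintro ⟨q, hq⟩ hTq
    refine Subtype.ext (h q (mem_degreeLT.1 hq) fun i hi => ?_)
    simpa [T] using congrFun hTq ⟨i, hi⟩
  have hfin : FiniteDimensional K (degreeLT K k) :=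
    Module.Finite.equiv (degreeLTEquiv K k).symm
  have hS : Function.Surjective T := (LinearMap.injective_iff_surjective_of_finrank_eq_finrank
    (LinearEquiv.finrank_eq (degreeLTEquiv K k))).1 hT
  -- Surjectivity of the Hankel map supplies the lower-order part that corrects `X ^ k`.
  obtain ⟨⟨r, hr⟩, hTr⟩ := hS fun i => -moment a (X ^ (i : ℕ) * X ^ k)
  have hr' := mem_degreeLT.1 hr
  refine ⟨X ^ k + r, monic_X_pow_add hr', ?_, fun i hi => ?_⟩
  · rw [add_comm]
    exact natDegree_eq_of_degree_eq_some
      ((degree_add_eq_right_of_degree_lt (by rwa [degree_X_pow])).trans (degree_X_pow k))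
  have := congrFun hTr ⟨i, hi⟩
  simp only [T, LinearMap.pi_apply, LinearMap.comp_apply, LinearMap.mulLeft_apply,
    Submodule.subtype_apply] at this
  rw [mul_add, map_add, this, add_neg_cancel]

/-- Every polynomial of degree less than `k + m` is `r + s * q` with `deg r < k`, `deg s < m`. -/
theorem exists_eq_add_mul {q : K[X]} (hq : q.Monic) {k m : ℕ} (hk : q.natDegree = k) {u : K[X]}
    (hu : u.degree < ((k + m : ℕ) : WithBot ℕ)) :
    ∃ r s : K[X], r.degree < k ∧ s.degree < m ∧ u = r + q * s := by
  have hqd : q.degree = k := by rw [degree_eq_natDegree hq.ne_zero, hk]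
  refine ⟨u %ₘ q, u /ₘ q, hqd ▸ degree_modByMonic_lt u hq, ?_, (modByMonic_add_div u q).symm⟩
  by_cases h0 : u /ₘ q = 0
  · rw [h0, degree_zero]; exact WithBot.bot_lt_coe m
  · rw [← natDegree_lt_iff_degree_lt h0, natDegree_divByMonic u hq, hk]
    have hu0 : u ≠ 0 := by rintro rfl; simp at h0
    have := (natDegree_lt_iff_degree_lt hu0).2 hu
    have h1 : ¬ u.degree < q.degree := fun h => h0 ((divByMonic_eq_zero_iff hq).2 h)
    rw [hqd, ← natDegree_lt_iff_degree_lt hu0] at h1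
    omega

/-- If the orthogonal polynomial of degree `k` has nonzero moment against `X ^ k`, the next Hankel
matrix is nonsingular. -/
theorem HankelNonsingular.succ {a : ℕ → K} {k : ℕ} (h : HankelNonsingular a k) {q : K[X]}
    (hq : q.Monic) (hk : q.natDegree = k) (ho : ∀ i < k, moment a (X ^ i * q) = 0)
    (hne : moment a (X ^ k * q) ≠ 0) : HankelNonsingular a (k + 1) := by
  intro u hu hm
  obtain ⟨r, s, hr, hs, rfl⟩ := exists_eq_add_mul hq hk hu
  obtain ⟨c, rfl⟩ : ∃ c, s = C c :=
    ⟨_, eq_C_of_degree_le_zero (Nat.WithBot.lt_one_iff_le_zero.1 (by exact_mod_cast hs))⟩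
  have key : ∀ i, moment a (X ^ i * (r + q * C c)) =
      moment a (X ^ i * r) + c * moment a (X ^ i * q) := by
    intro i
    rw [show X ^ i * (r + q * C c) = X ^ i * r + c • (X ^ i * q) by
      rw [smul_eq_C_mul]; ring, map_add, map_smul, smul_eq_mul]
  have hr0 : r = 0 := h r hr fun i hi => by
    have := hm i (by omega)
    rwa [key, ho i hi, mul_zero, add_zero] at this
  subst hr0
  have := hm k (by omega)
  rw [key, mul_zero, map_zero, zero_add] at this
  simp [(mul_eq_zero.1 this).resolve_right hne]

/-- If the orthogonal polynomial of degree `k` annihilates `X ^ k` but not `X ^ (k + 1)`, the second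
next Hankel matrix is nonsingular. -/
theorem HankelNonsingular.add_two {a : ℕ → K} {k : ℕ} (h : HankelNonsingular a k) {q : K[X]}
    (hq : q.Monic) (hk : q.natDegree = k) (ho : ∀ i < k + 1, moment a (X ^ i * q) = 0)
    (hne : moment a (X ^ (k + 1) * q) ≠ 0) : HankelNonsingular a (k + 2) := by
  intro u hu hm
  obtain ⟨r, s, hr, hs, rfl⟩ := exists_eq_add_mul hq hk hu
  obtain ⟨c, d, rfl⟩ : ∃ c d, s = C c * X + C d :=
    ⟨_, _, eq_X_add_C_of_degree_le_one (Order.le_of_lt_succ (by exact_mod_cast hs))⟩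
  have key : ∀ i, moment a (X ^ i * (r + q * (C c * X + C d))) =
      moment a (X ^ i * r) + c * moment a (X ^ (i + 1) * q) + d * moment a (X ^ i * q) := by
    intro i
    rw [show X ^ i * (r + q * (C c * X + C d)) =
      X ^ i * r + c • (X ^ (i + 1) * q) + d • (X ^ i * q) by
        rw [smul_eq_C_mul, smul_eq_C_mul]; ring]
    simp only [map_add, map_smul, smul_eq_mul]
  have hr0 : r = 0 := h r hr fun i hi => by
    have := hm i (by omega)
    rwa [key, ho i (by omega), ho (i + 1) (by omega), mul_zero, mul_zero, add_zero, add_zero]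
      at this
  subst hr0
  -- The last two rows are triangular: row `k` gives `c = 0`, then row `k + 1` gives `d = 0`. The
  -- moment of `X ^ (k + 2) * q`, the only one to involve the term `2 * k + 2`, is multiplied by
  -- `c`, so that term is unconstrained.
  have h1 := hm k (by omega)
  rw [key, mul_zero, map_zero, zero_add, ho k (by omega), mul_zero, add_zero] at h1
  have hc := (mul_eq_zero.1 h1).resolve_right hne
  have h2 := hm (k + 1) (by omega)
  rw [key, mul_zero, map_zero, zero_add, hc, zero_mul, zero_add] at h2
  simp [hc, (mul_eq_zero.1 h2).resolve_right hne]

theorem moment_eq_add (a : ℕ → K) (p : K[X]) (n : ℕ) :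
    moment a p = moment a (p - X ^ n) + a n := by
  rw [map_sub, ← monomial_one_right_eq_X_pow, moment_monomial]; ring

theorem degree_monic_sub_X_pow_lt {p : K[X]} {n : ℕ} (hp : p.Monic) (hn : p.natDegree = n) :
    (p - X ^ n).degree < (n : WithBot ℕ) := by
  have hd : p.degree = n := by rw [degree_eq_natDegree hp.ne_zero, hn]
  rw [← hd]
  exact degree_sub_lt_left (by rw [degree_X_pow, hd]) hp.ne_zero
    (by rw [hp.leadingCoeff, leadingCoeff_X_pow])

/-- For sequences that agree below `n`, the `n`th moments differ as the `n`th terms. -/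
theorem moment_monic_congr {a b : ℕ → K} {p : K[X]} {n : ℕ} (hp : p.Monic) (hn : p.natDegree = n)
    (hab : ∀ i < n, a i = b i) : moment a p = moment b (p - X ^ n) + a n := by
  rw [moment_eq_add, moment_congr hab (degree_monic_sub_X_pow_lt hp hn)]

theorem natDegree_X_pow_mul_monic {q : K[X]} (hq : q.Monic) {k : ℕ} (hk : q.natDegree = k) (i : ℕ) :
    (X ^ i * q).natDegree = i + k := by
  rw [(monic_X_pow i).natDegree_mul hq, natDegree_X_pow, hk]

/-- Given the terms below `2 * k`, all but one value of the next term make the Hankel matrix of size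
`k + 1` nonsingular. -/
theorem HankelNonsingular.exists_forall_succ {a : ℕ → K} {k : ℕ} (h : HankelNonsingular a k) :
    ∃ v : K, ∀ b : ℕ → K, (∀ i < 2 * k, b i = a i) → b (2 * k) ≠ v →
      HankelNonsingular b (k + 1) := by
  obtain ⟨q, hq, hk, ho⟩ := h.exists_monic
  -- As `X ^ k * q` is monic of degree `2 * k`, exactly this value of the term `2 * k` makes its
  -- moment vanish.
  refine ⟨-moment a (X ^ k * q - X ^ (2 * k)), fun b hb hne => ?_⟩
  refine HankelNonsingular.succ (h.congr fun i hi => (hb i (by omega)).symm) hq hk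
    (fun i hi => ?_) ?_
  · rw [← ho i hi]
    refine moment_congr (n := i + (k + 1)) (fun j hj => hb j (by omega))
      (degree_X_pow_mul_lt ?_ i)
    rw [degree_eq_natDegree hq.ne_zero, hk]
    exact_mod_cast Nat.lt_succ_self k
  · rw [moment_monic_congr ((monic_X_pow k).mul hq)
      ((natDegree_X_pow_mul_monic hq hk k).trans (two_mul k).symm) hb]
    intro h0
    exact hne (eq_neg_of_add_eq_zero_right h0)

/-- After a nonsingular Hankel matrix of size `k` and a singular one of size `k + 1`, all but one
value of the next term make the one of size `k + 2` nonsingular. -/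
theorem HankelNonsingular.exists_forall_add_two {a : ℕ → K} {k : ℕ} (h : HankelNonsingular a k)
    (h' : ¬ HankelNonsingular a (k + 1)) :
    ∃ v : K, ∀ b : ℕ → K, (∀ i < 2 * k + 1, b i = a i) → b (2 * k + 1) ≠ v →
      HankelNonsingular b (k + 2) := by
  obtain ⟨q, hq, hk, ho⟩ := h.exists_monic
  have ho' : ∀ i < k + 1, moment a (X ^ i * q) = 0 := by
    intro i hi
    rcases Nat.lt_succ_iff_lt_or_eq.1 hi with hi | rfl
    · exact ho i hi
    · by_contra hne
      exact h' (h.succ hq hk ho hne)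
  refine ⟨-moment a (X ^ (k + 1) * q - X ^ (2 * k + 1)), fun b hb hne => ?_⟩
  refine HankelNonsingular.add_two (h.congr fun i hi => (hb i (by omega)).symm) hq hk
    (fun i hi => ?_) ?_
  · rw [← ho' i hi]
    refine moment_congr (n := i + (k + 1)) (fun j hj => hb j (by omega))
      (degree_X_pow_mul_lt ?_ i)
    rw [degree_eq_natDegree hq.ne_zero, hk]
    exact_mod_cast Nat.lt_succ_self k
  · rw [moment_monic_congr ((monic_X_pow (k + 1)).mul hq)
      ((natDegree_X_pow_mul_monic hq hk (k + 1)).trans (by ring)) hb]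
    intro h0
    exact hne (eq_neg_of_add_eq_zero_right h0)

/-! ### Choosing the coefficients -/

/-- Extensions of finite prefixes can be iterated to give a full sequence. -/
theorem exists_sequence_of_extension (g : ℕ → K) (m : ℕ)
    (ext : ∀ (k : ℕ) (a : ℕ → K), HankelNonsingular a k → HankelNonsingular (g - a) k →
      ∃ (k' : ℕ) (a' : ℕ → K), k < k' ∧ k' ≤ k + m ∧ (∀ i < 2 * k, a' i = a i) ∧
        (∀ j, k < j → j ≤ k' → HankelNonsingular a' j) ∧ HankelNonsingular (g - a') k') :
    ∃ a : ℕ → K, (∀ k, HankelNonsingular a k) ∧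
      ∀ k, ∃ j, k < j ∧ j ≤ k + m ∧ HankelNonsingular (g - a) j := by
  let S := {s : ℕ × (ℕ → K) // HankelNonsingular s.2 s.1 ∧ HankelNonsingular (g - s.2) s.1}
  have hstep : ∀ s : S, ∃ s' : S, s.1.1 < s'.1.1 ∧ s'.1.1 ≤ s.1.1 + m ∧
      (∀ i < 2 * s.1.1, s'.1.2 i = s.1.2 i) ∧
      ∀ j, s.1.1 < j → j ≤ s'.1.1 → HankelNonsingular s'.1.2 j := by
    rintro ⟨⟨k, a⟩, h1, h2⟩
    obtain ⟨k', a', h3, h4, h5, h6, h7⟩ := ext k a h1 h2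
    exact ⟨⟨⟨k', a'⟩, h6 k' h3 le_rfl, h7⟩, h3, h4, h5, h6⟩
  choose f hlt hle hagree hns using hstep
  let s : ℕ → S := fun n =>
    Nat.rec ⟨⟨0, 0⟩, hankelNonsingular_zero _, hankelNonsingular_zero _⟩ (fun _ => f) n
  have hs : ∀ n, s (n + 1) = f (s n) := fun _ => rfl
  let κ : ℕ → ℕ := fun n => (s n).1.1
  have hκ : StrictMono κ := strictMono_nat_of_lt_succ fun n => hlt (s n)
  have hag : ∀ n d i, i < 2 * κ n → (s (n + d)).1.2 i = (s n).1.2 i := by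
    intro n d i hi
    induction d with
    | zero => rfl
    | succ d ih =>
      rw [← ih, ← add_assoc, hs]
      exact hagree _ i (hi.trans_le (Nat.mul_le_mul_left 2 (hκ.monotone (Nat.le_add_right n d))))
  -- Since `κ (i + 1) ≥ i + 1`, the term `i` is final at stage `i + 1`.
  let A : ℕ → K := fun i => (s (i + 1)).1.2 i
  have hA : ∀ n i, i < 2 * κ n → A i = (s n).1.2 i := by
    intro n i hi
    rcases le_total n (i + 1) with h | h
    · obtain ⟨d, hd⟩ := Nat.exists_eq_add_of_le h
      simp only [A, hd]
      exact hag n d i hi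
    · obtain ⟨d, rfl⟩ := Nat.exists_eq_add_of_le h
      have := hκ.id_le (i + 1)
      exact (hag (i + 1) d i (by simp only [id] at this; omega)).symm
  have hex : ∀ k, ∃ n, κ n ≤ k ∧ k < κ (n + 1) := by
    intro k
    induction k with
    | zero => exact ⟨0, le_rfl, hlt (s 0)⟩
    | succ k ih =>
      obtain ⟨n, h1, h2⟩ := ih
      by_cases h : k + 1 < κ (n + 1)
      · exact ⟨n, by omega, h⟩
      · have := hκ (show n + 1 < n + 1 + 1 by omega)
        exact ⟨n + 1, by omega, by omega⟩
  refine ⟨A, fun k => ?_, fun k => ?_⟩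
  · cases k with
    | zero => exact hankelNonsingular_zero A
    | succ k =>
      obtain ⟨n, h1, h2⟩ := hex k
      exact (hns (s n) (k + 1) (Nat.lt_succ_of_le h1) h2).congr
        fun i hi => (hA (n + 1) i (by omega)).symm
  · obtain ⟨n, h1, h2⟩ := hex k
    refine ⟨κ (n + 1), h2, (hle (s n)).trans (Nat.add_le_add_right h1 m),
      (s (n + 1)).2.2.congr fun i hi => ?_⟩
    change i < 2 * κ (n + 1) - 1 at hi
    rw [Pi.sub_apply, Pi.sub_apply, hA (n + 1) i (by omega)]

theorem exists_sequence_one (g : ℕ → K) (hK : ∀ u v : K, ∃ x, x ≠ u ∧ x ≠ v) :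
    ∃ a : ℕ → K, (∀ k, HankelNonsingular a k) ∧
      ∀ k, ∃ j, k < j ∧ j ≤ k + 1 ∧ HankelNonsingular (g - a) j := by
  refine exists_sequence_of_extension g 1 fun k a ha hb => ?_
  obtain ⟨u, hu⟩ := ha.exists_forall_succ
  obtain ⟨v, hv⟩ := hb.exists_forall_succ
  -- The value `v` forbidden for `g - a` forbids `g (2 * k) - v` for `a`.
  obtain ⟨x, hxu, hxv⟩ := hK u (g (2 * k) - v)
  have hag : ∀ i < 2 * k, Function.update a (2 * k) x i = a i :=
    fun i hi => Function.update_of_ne hi.ne _ _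
  refine ⟨k + 1, Function.update a (2 * k) x, k.lt_succ_self, le_rfl, hag, fun j h1 h2 => ?_, ?_⟩
  · obtain rfl : j = k + 1 := by omega
    exact hu _ hag (by simpa using hxu)
  · refine hv _ (fun i hi => by rw [Pi.sub_apply, Pi.sub_apply, hag i hi]) ?_
    rw [Pi.sub_apply, Function.update_self]
    rintro rfl
    exact hxv (sub_sub_cancel _ _).symm

/-- The term `2 * k` serves size `k + 1` of `a`. If `g - a` is singular there, the term `2 * k + 1`
makes its size `k + 2` nonsingular whatever comes next, leaving the term `2 * k + 2` free to serve
size `k + 2` of `a`. -/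
theorem exists_sequence_two (g : ℕ → K) :
    ∃ a : ℕ → K, (∀ k, HankelNonsingular a k) ∧
      ∀ k, ∃ j, k < j ∧ j ≤ k + 2 ∧ HankelNonsingular (g - a) j := by
  refine exists_sequence_of_extension g 2 fun k a ha hb => ?_
  have hone : ∀ (k : ℕ) (a : ℕ → K), HankelNonsingular a k →
      ∃ a', (∀ i, i ≠ 2 * k → a' i = a i) ∧ HankelNonsingular a' (k + 1) := by
    intro k a ha
    obtain ⟨u, hu⟩ := ha.exists_forall_succ
    obtain ⟨x, hx⟩ := exists_ne u
    have hag : ∀ i, i ≠ 2 * k → Function.update a (2 * k) x i = a i :=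
      fun i hi => Function.update_of_ne hi _ _
    exact ⟨_, hag, hu _ (fun i hi => hag i hi.ne) (by simpa using hx)⟩
  obtain ⟨a₁, hag₁, ha₁⟩ := hone k a ha
  by_cases hb₁ : HankelNonsingular (g - a₁) (k + 1)
  · refine ⟨k + 1, a₁, k.lt_succ_self, Nat.le_succ _, fun i hi => hag₁ i hi.ne,
      fun j h1 h2 => ?_, hb₁⟩
    obtain rfl : j = k + 1 := by omega
    exact ha₁
  have hb₀ : HankelNonsingular (g - a₁) k :=
    hb.congr fun i hi => by rw [Pi.sub_apply, Pi.sub_apply, hag₁ i (by omega)]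
  obtain ⟨v, hv⟩ := hb₀.exists_forall_add_two hb₁
  obtain ⟨y, hy⟩ := exists_ne (g (2 * k + 1) - v)
  set a₂ := Function.update a₁ (2 * k + 1) y with ha₂
  have hag₂ : ∀ i, i ≠ 2 * k + 1 → a₂ i = a₁ i := fun i hi => Function.update_of_ne hi _ _
  have hns₂ : HankelNonsingular a₂ (k + 1) := ha₁.congr fun i hi => (hag₂ i (by omega)).symm
  obtain ⟨a₃, hag₃, ha₃⟩ := hone (k + 1) a₂ hns₂
  refine ⟨k + 2, a₃, by omega, le_rfl, fun i hi => ?_, fun j h1 h2 => ?_, ?_⟩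
  · rw [hag₃ i (by omega), hag₂ i (by omega), hag₁ i (by omega)]
  · obtain rfl | rfl : j = k + 1 ∨ j = k + 2 := by omega
    · exact hns₂.congr fun i hi => (hag₃ i (by omega)).symm
    · exact ha₃
  · refine hv _ (fun i hi => ?_) ?_
    · rw [Pi.sub_apply, Pi.sub_apply, hag₃ i (by omega), hag₂ i (by omega)]
    · rw [Pi.sub_apply, hag₃ _ (by omega), ha₂, Function.update_self]
      rintro rfl
      exact hy (sub_sub_cancel _ _).symm

/-! ### From Hankel matrices to partial quotients -/

theorem coeff_mul_eq_zero_of_lt {α β : K⸨X⸩} {x y : ℤ} (hα : ∀ m < x, α.coeff m = 0)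
    (hβ : ∀ m < y, β.coeff m = 0) {m : ℤ} (hm : m < x + y) : (α * β).coeff m = 0 := by
  rw [HahnSeries.coeff_mul]
  refine Finset.sum_eq_zero fun ij hij => ?_
  rw [Finset.mem_antidiagonal] at hij
  rcases lt_or_ge ij.1 x with h | h
  · rw [hα _ h, zero_mul]
  · rw [hβ _ (by omega), mul_zero]

theorem ofPoly_monomial (n : ℕ) (c : K) :
    ofPoly K (monomial n c) = HahnSeries.single (-(n : ℤ)) c := by
  simp [ofPoly, HahnSeries.C_apply, HahnSeries.single_pow, HahnSeries.single_mul_single]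

/-- Hence the kernel of size `k` consists of the `q` of degree less than `k` for which `q * α` has
zero coefficients at `t⁻¹, …, t⁻ᵏ`. -/
theorem coeff_ofPoly_mul (q : K[X]) (α : K⸨X⸩) (i : ℕ) :
    (ofPoly K q * α).coeff (i + 1) = moment (fun j => α.coeff (j + 1)) (X ^ i * q) := by
  induction q using Polynomial.induction_on' with
  | add p q hp hq => simp only [map_add, add_mul, mul_add, HahnSeries.coeff_add, hp, hq]
  | monomial n c =>
    rw [ofPoly_monomial, ← monomial_one_right_eq_X_pow, monomial_mul_monomial, moment_monomial,
      show ((i : ℤ) + 1) = ((i + n : ℕ) + 1 : ℤ) + -(n : ℤ) by push_cast; ring,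
      HahnSeries.coeff_single_mul_add]
    ring

theorem coeff_ofPoly_neg (q : K[X]) (n : ℕ) : (ofPoly K q).coeff (-(n : ℤ)) = q.coeff n := by
  induction q using Polynomial.induction_on' with
  | add p q hp hq => simp only [map_add, HahnSeries.coeff_add, coeff_add, hp, hq]
  | monomial m c =>
    rw [ofPoly_monomial, HahnSeries.coeff_single, coeff_monomial]
    simp [eq_comm]

theorem coeff_ofPoly_of_pos (q : K[X]) {n : ℤ} (hn : 0 < n) : (ofPoly K q).coeff n = 0 := by
  induction q using Polynomial.induction_on' with
  | add p q hp hq => simp only [map_add, HahnSeries.coeff_add, hp, hq, add_zero]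
  | monomial m c =>
    rw [ofPoly_monomial]
    exact HahnSeries.coeff_single_of_ne (by omega)

theorem coeff_ofPoly_of_lt {q : K[X]} {k : ℕ} (hq : q.degree < k) {n : ℤ} (hn : n < 1 - k) :
    (ofPoly K q).coeff n = 0 := by
  rcases lt_or_ge 0 n with h | h
  · exact coeff_ofPoly_of_pos q h
  · obtain ⟨j, rfl⟩ : ∃ j : ℕ, n = -(j : ℤ) := ⟨(-n).toNat, by omega⟩
    rw [coeff_ofPoly_neg]
    exact coeff_eq_zero_of_degree_lt (hq.trans_le (by exact_mod_cast (by omega : k ≤ j)))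

theorem order_inv_eq_neg (α : K⸨X⸩) : α⁻¹.order = -α.order := by
  by_cases h : α = 0
  · simp [h]
  · have := HahnSeries.order_mul h (inv_ne_zero h)
    rw [mul_inv_cancel₀ h, HahnSeries.order_one] at this
    omega

/-- The fractional part of a Laurent series. -/
noncomputable def fracPart (α : K⸨X⸩) : K⸨X⸩ := α - ofPoly K (polyPart α)

theorem coeff_fracPart_of_pos (α : K⸨X⸩) {n : ℤ} (hn : 0 < n) :
    (fracPart α).coeff n = α.coeff n := by
  rw [fracPart, HahnSeries.coeff_sub, coeff_ofPoly_of_pos _ hn, sub_zero]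

theorem coeff_fracPart_of_lt (α : K⸨X⸩) {n : ℤ} (hn : n < 1) : (fracPart α).coeff n = 0 := by
  obtain ⟨m, rfl⟩ : ∃ m : ℕ, n = -(m : ℤ) := ⟨(-n).toNat, by omega⟩
  rw [fracPart, HahnSeries.coeff_sub, coeff_ofPoly_neg, coeff_polyPart, sub_self]

theorem one_le_order_fracPart {α : K⸨X⸩} (h : fracPart α ≠ 0) : 1 ≤ (fracPart α).order := by
  by_contra hlt
  exact HahnSeries.coeff_order_eq_zero.not.2 h (coeff_fracPart_of_lt α (not_le.1 hlt))

/-- Let `f` be the fractional part, `p` a kernel vector for `f⁻¹`, and `p * f⁻¹ = q + s` with `q`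
the polynomial part. Then `s` has order above `k`, so `q * f = p - s * f` puts `q` in the kernel of
size `k + d` for `α`. Thus `q = 0`, and the polynomial `p = s * f` has only negative powers of `t`,
so it is zero. -/
theorem HankelNonsingular.coeff_inv_fracPart {α : K⸨X⸩} (hf : fracPart α ≠ 0) {d k : ℕ}
    (hd : (fracPart α).order = d)
    (h : HankelNonsingular (fun i => α.coeff (i + 1)) (k + d)) :
    HankelNonsingular (fun i => (fracPart α)⁻¹.coeff (i + 1)) k := by
  intro p hp hm
  have hβ : ∀ m < -(d : ℤ), (fracPart α)⁻¹.coeff m = 0 := fun m hm =>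
    HahnSeries.coeff_eq_zero_of_lt_order (by rwa [order_inv_eq_neg, hd])
  have hfd : ∀ m < (d : ℤ), (fracPart α).coeff m = 0 := fun m hm =>
    HahnSeries.coeff_eq_zero_of_lt_order (by rwa [hd])
  set τ := ofPoly K p * (fracPart α)⁻¹ with hτ
  have hs : ∀ m < (k + 1 : ℤ), (fracPart τ).coeff m = 0 := by
    intro m hmk
    rcases lt_or_ge m 1 with h1 | h1
    · exact coeff_fracPart_of_lt τ h1
    · obtain ⟨i, rfl⟩ : ∃ i : ℕ, m = i + 1 := ⟨(m - 1).toNat, by omega⟩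
      rw [coeff_fracPart_of_pos τ (by omega), hτ, coeff_ofPoly_mul]
      exact hm i (by omega)
  have hsf : ∀ m < (k + 1 + d : ℤ), (fracPart τ * fracPart α).coeff m = 0 :=
    fun m hm => coeff_mul_eq_zero_of_lt hs hfd hm
  have hqf : ofPoly K (polyPart τ) * fracPart α = ofPoly K p - fracPart τ * fracPart α := by
    rw [fracPart.eq_1 τ, sub_mul, hτ, inv_mul_cancel_right₀ hf, sub_sub_cancel]
  have hq0 : polyPart τ = 0 := by
    refine h _ ?_ fun i hi => ?_
    · rw [degree_lt_iff_coeff_zero]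
      intro n hn
      rw [coeff_polyPart]
      refine coeff_mul_eq_zero_of_lt (fun m hm => coeff_ofPoly_of_lt hp hm) hβ ?_
      omega
    · have h1 := congrArg (HahnSeries.coeff · (i + 1 : ℤ)) hqf
      simp only [HahnSeries.coeff_sub] at h1
      rw [coeff_ofPoly_of_pos p (by omega), hsf _ (by omega), coeff_ofPoly_mul, sub_zero] at h1
      rw [← h1]
      congr 2
      funext j
      rw [coeff_fracPart_of_pos α (by omega)]
  ext n
  rw [hq0, map_zero, zero_mul, eq_comm, sub_eq_zero] at hqf
  rw [← coeff_ofPoly_neg, hqf, hsf _ (by omega), coeff_zero]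

theorem completeQuotient_succ {α β : K⸨X⸩} {n : ℕ} (h : completeQuotient α n = some β)
    (hβ : fracPart β ≠ 0) : completeQuotient α (n + 1) = some (fracPart β)⁻¹ := by
  rw [completeQuotient, h, Option.bind_some]
  exact if_neg hβ

/-- A series such that among `m` consecutive Hankel matrices of its coefficients there is always a
nonsingular one has partial quotients of degree at most `m`. -/
theorem mem_F_of_hankelNonsingular {α : K⸨X⸩} {m : ℕ}
    (h : ∀ k, ∃ j, k < j ∧ j ≤ k + m ∧ HankelNonsingular (fun i => α.coeff (i + 1)) j) :
    α ∈ F K m := by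
  have hf0 : ∀ β : K⸨X⸩,
      (∀ k, ∃ j, k < j ∧ j ≤ k + m ∧ HankelNonsingular (fun i => β.coeff (i + 1)) j) →
      fracPart β ≠ 0 ∧ (fracPart β).order ≤ m := by
    intro β hβ
    obtain ⟨j, h1, h2, h3⟩ := hβ 0
    have : ∃ i < j, β.coeff (i + 1) ≠ 0 := by
      by_contra! hne
      -- If the first `j` coefficients vanish, the polynomial `1` lies in the kernel.
      refine one_ne_zero (h3 1 (by rw [degree_one]; exact_mod_cast h1) fun i hi => ?_)
      rw [mul_one, ← monomial_one_right_eq_X_pow, moment_monomial, hne i hi, zero_mul]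
    obtain ⟨i, hi, hne⟩ := this
    rw [← coeff_fracPart_of_pos β (by omega)] at hne
    refine ⟨fun h0 => hne (by rw [h0, HahnSeries.coeff_zero]), ?_⟩
    exact (HahnSeries.order_le_of_coeff_ne_zero hne).trans (by omega)
  -- The gap condition passes to the next complete quotient, as all sizes shift down by the same
  -- `d`.
  have key : ∀ n, ∃ β, completeQuotient α n = some β ∧
      (∀ k, ∃ j, k < j ∧ j ≤ k + m ∧ HankelNonsingular (fun i => β.coeff (i + 1)) j) ∧
      (1 ≤ n → (polyPart β).degree ≤ (m : WithBot ℕ)) := by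
    intro n
    induction n with
    | zero => exact ⟨α, rfl, h, by omega⟩
    | succ n ih =>
      obtain ⟨β, hβ, hN, -⟩ := ih
      obtain ⟨hf, hdm⟩ := hf0 β hN
      have hd1 := one_le_order_fracPart hf
      obtain ⟨d, hd⟩ : ∃ d : ℕ, (fracPart β).order = d := ⟨_, (Int.toNat_of_nonneg (by omega)).symm⟩
      refine ⟨_, completeQuotient_succ hβ hf, fun k => ?_, fun _ => ?_⟩
      · obtain ⟨j, h1, h2, h3⟩ := hN (k + d)
        obtain ⟨i, rfl⟩ : ∃ i, j = i + d := ⟨j - d, by omega⟩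
        exact ⟨i, by omega, by omega, h3.coeff_inv_fracPart hf hd⟩
      · rw [degree_le_iff_coeff_zero]
        intro i hi
        rw [coeff_polyPart]
        refine HahnSeries.coeff_eq_zero_of_lt_order ?_
        rw [order_inv_eq_neg]
        have : m < i := by exact_mod_cast hi
        omega
  intro n hn
  obtain ⟨β, hβ, -, hdeg⟩ := key n
  exact ⟨polyPart β, by rw [partialQuotient, hβ, Option.map_some], hdeg hn⟩

/-! ### Obstruction at `t⁻¹` and the sum sets -/

/-- The order of the fractional part is at most the degree of the partial quotient `a₁`, so it is
`1`. -/
theorem coeff_one_ne_zero_of_mem_F_one {α : K⸨X⸩} (h : α ∈ F K 1) : α.coeff 1 ≠ 0 := by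
  obtain ⟨a, ha, hdeg⟩ := h 1 le_rfl
  by_cases hf : fracPart α = 0
  · have : completeQuotient α 1 = none := by
      rw [completeQuotient, completeQuotient, Option.bind_some]
      exact if_pos hf
    simp [partialQuotient, this] at ha
  rw [partialQuotient, completeQuotient_succ rfl hf, Option.map_some, Option.some_inj] at ha
  have hd1 := one_le_order_fracPart hf
  obtain ⟨d, hd⟩ : ∃ d : ℕ, (fracPart α).order = d := ⟨_, (Int.toNat_of_nonneg (by omega)).symm⟩
  have hne : a.coeff d ≠ 0 := by
    rw [← ha, coeff_polyPart, ← hd, ← order_inv_eq_neg]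
    exact HahnSeries.coeff_order_eq_zero.not.2 (inv_ne_zero hf)
  have hle : d ≤ 1 := by exact_mod_cast (le_degree_of_ne_zero hne).trans hdeg
  obtain rfl : d = 1 := by omega
  rw [← coeff_fracPart_of_pos α one_pos]
  have := HahnSeries.coeff_order_eq_zero.not.2 hf
  rwa [hd] at this

/-- The polynomial part of `γ` goes into `γ - α`, where it is harmless: `a₀` is unrestricted. -/
theorem F_add_F_one_eq_univ {m : ℕ}
    (h : ∀ g : ℕ → K, ∃ a : ℕ → K, (∀ k, HankelNonsingular a k) ∧
      ∀ k, ∃ j, k < j ∧ j ≤ k + m ∧ HankelNonsingular (g - a) j) :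
    F K m + F K 1 = Set.univ := by
  refine Set.eq_univ_of_forall fun γ => ?_
  obtain ⟨a, ha, hb⟩ := h fun i => γ.coeff (i + 1)
  let α : K⸨X⸩ := HahnSeries.single (1 : ℤ) 1 * HahnSeries.ofPowerSeries ℤ K (PowerSeries.mk a)
  have hα : ∀ i : ℕ, α.coeff (i + 1) = a i := by
    intro i
    rw [HahnSeries.coeff_single_mul_add, one_mul, HahnSeries.ofPowerSeries_apply_coeff,
      PowerSeries.coeff_mk]
  refine Set.mem_add.2 ⟨γ - α, mem_F_of_hankelNonsingular fun k => ?_, α,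
    mem_F_of_hankelNonsingular fun k => ⟨k + 1, k.lt_succ_self, le_rfl, ?_⟩, sub_add_cancel γ α⟩
  · simp only [HahnSeries.coeff_sub, hα]
    exact hb k
  · simp only [hα]
    exact ha _

end LaurentCF

theorem theorem1 (K : Type*) [Field K] :
    (IsEmpty (K ≃+* ZMod 2) →
      LaurentCF.F K 1 + LaurentCF.F K 1 = (Set.univ : Set K⸨X⸩)) ∧
    (Nonempty (K ≃+* ZMod 2) →
      LaurentCF.F K 1 + LaurentCF.F K 1 ≠ (Set.univ : Set K⸨X⸩) ∧
      LaurentCF.tInv K ∉ LaurentCF.F K 1 + LaurentCF.F K 1 ∧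
      LaurentCF.F K 2 + LaurentCF.F K 1 = (Set.univ : Set K⸨X⸩)) := by
  refine ⟨fun hK => ?_, fun ⟨e⟩ => ?_⟩
  · refine LaurentCF.F_add_F_one_eq_univ fun g => LaurentCF.exists_sequence_one g fun u v => ?_
    -- Otherwise `K = {u, v}` has two elements.
    by_contra! hne
    classical
    have hmem : ∀ x, x ∈ ({u, v} : Finset K) := fun x => by
      by_cases h : x = u
      · simp [h]
      · simp [hne x h]
    let _ : Fintype K := ⟨{u, v}, hmem⟩
    have h2 : Fintype.card K = 2 := le_antisymm Finset.card_le_two Fintype.one_lt_card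
    exact hK.false (ZMod.ringEquivOfPrime K Nat.prime_two h2).symm
  · have ht : LaurentCF.tInv K ∉ LaurentCF.F K 1 + LaurentCF.F K 1 := by
      intro hmem
      obtain ⟨α, hα, β, hβ, hsum⟩ := Set.mem_add.1 hmem
      have h1 := LaurentCF.coeff_one_ne_zero_of_mem_F_one hα
      have h2 := LaurentCF.coeff_one_ne_zero_of_mem_F_one hβ
      have h3 := congrArg (HahnSeries.coeff · (1 : ℤ)) hsum
      simp only [HahnSeries.coeff_add, LaurentCF.tInv, HahnSeries.coeff_single_same] at h3
      have key : ∀ x y : ZMod 2, x ≠ 0 → y ≠ 0 → x + y ≠ 1 := by decide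
      refine key (e (α.coeff 1)) (e (β.coeff 1)) ?_ ?_ ?_
      · simpa using h1
      · simpa using h2
      · rw [← map_add, h3, map_one]
    exact ⟨fun h => ht (h ▸ Set.mem_univ _), ht,
      LaurentCF.F_add_F_one_eq_univ LaurentCF.exists_sequence_two⟩
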